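/- Let $0<H<1$, $d=H-\tfrac12$ and $\sigma>0$. Let $X=(X_n)_{n\in\mathbb Z}$ be an ARFIMA$(0,d,0)$ process with variance $\operatorname{Var}(X_n)=\sigma^2$; that is, $X$ is a (second-order) stationary process whose autocovariance $\gamma(k)=\operatorname{Cov}(X_0,X_k)$ tends to $0$ as $k\to\infty$, and there are independent random variables $(\varepsilon_n)_{n\in\mathbb Z}$ with a common normal law $N(0,\sigma_\varepsilon^2)$ such that $$(1-L)^dX_n=\sum_{k=0}^{\infty}(-1)^k\binom dk X_{n-k}=\varepsilon_n\qquad(n\in\mathbb Z),$$ where $L$ is the lag operator, $LX_n=X_{n-1}$, and the series converges in mean square. For every $n$ the vector $(X_1,\dots,X_n)$ has a density $f_n$ with respect to Lebesgue measure and a finite differential entropy $h(X_1,\dots,X_n)=-\int f_n\log f_n\,dx$ (natural logarithm), and the differential entropy rate of $X$ exists and equals $$\lim_{n\to\infty}\frac{h(X_1,\dots,X_n)}{n}=\frac12\log(2\pi e\,\sigma^2)+\log\Gamma\!\left(\tfrac32-H\right)-\frac12\log\Gamma(2-2H).$$ -/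

import Mathlib

open MeasureTheory ProbabilityTheory Filter Topology

noncomputable section

/-- The coefficient of `z ^ k` in the binomial series of `(1 - z) ^ d`,
namely `(-1) ^ k * d (d - 1) ⋯ (d - k + 1) / k!`. -/
def fracDiffCoeff (d : ℝ) (k : ℕ) : ℝ := (-1) ^ k * Ring.choose d k

/-- `X` is a second-order stationary real process: finite second moments, constant mean and
covariances that depend on the lag only. -/
structure IsStationaryProcess {Ω : Type*} [MeasurableSpace Ω] (P : Measure Ω)
    (X : ℤ → Ω → ℝ) : Prop where
  memLp : ∀ n, MemLp (X n) 2 P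
  mean_eq : ∀ m n, ∫ ω, X m ω ∂P = ∫ ω, X n ω ∂P
  cov_shift : ∀ m n k, cov[X (m + k), X (n + k); P] = cov[X m, X n; P]

/-- `ε` is a sequence of independent centred normal variables with common variance `v`. -/
structure IsGaussianWhiteNoise {Ω : Type*} [MeasurableSpace Ω] (P : Measure Ω)
    (ε : ℤ → Ω → ℝ) (v : NNReal) : Prop where
  indep : iIndepFun ε P
  hasLaw : ∀ n, HasLaw (ε n) (gaussianReal 0 v) P

/-- `(1 - L) ^ d X = Y`, where `L` is the lag operator `(L X) n = X (n - 1)`: for each `n`,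
the series `∑ k, fracDiffCoeff d k * X (n - k)` converges to `Y n` in mean square. -/
def FracDiffEq {Ω : Type*} [MeasurableSpace Ω] (P : Measure Ω) (d : ℝ)
    (X Y : ℤ → Ω → ℝ) : Prop :=
  ∀ n : ℤ, Tendsto
    (fun N : ℕ => eLpNorm
      (fun ω => (∑ k ∈ Finset.range N, fracDiffCoeff d k * X (n - k) ω) - Y n ω) 2 P)
    atTop (𝓝 0)

/-- `X` is an ARFIMA(0,d,0) process: a stationary process, with autocovariance tending to zero
at infinity, that solves `(1 - L) ^ d X = ε` for some Gaussian white noise `ε`.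
(For `0 < d` the operator `(1 - L) ^ d` annihilates every random variable that is constant in
time; the decay of the autocovariance excludes such an additive component of positive
variance. It holds whenever `X` has a spectral density.) -/
structure IsARFIMA {Ω : Type*} [MeasurableSpace Ω] (P : Measure Ω) (d : ℝ)
    (X : ℤ → Ω → ℝ) : Prop where
  stationary : IsStationaryProcess P X
  cov_tendsto_zero : Tendsto (fun k : ℕ => cov[X 0, X k; P]) atTop (𝓝 0)
  exists_noise : ∃ (v : NNReal) (ε : ℤ → Ω → ℝ),
    IsGaussianWhiteNoise P ε v ∧ FracDiffEq P d X ε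

/-- The joint law of `X 1, …, X n`. -/
def jointLaw {Ω : Type*} [MeasurableSpace Ω] (P : Measure Ω) (X : ℤ → Ω → ℝ) (n : ℕ) :
    Measure (Fin n → ℝ) :=
  P.map (fun ω (i : Fin n) => X ((i : ℤ) + 1) ω)

/-- The density of a measure on `ℝⁿ` with respect to Lebesgue measure. -/
def lebesgueDensity {n : ℕ} (μ : Measure (Fin n → ℝ)) (x : Fin n → ℝ) : ℝ :=
  (μ.rnDeriv volume x).toReal

/-- The law `μ` on `ℝⁿ` has a density `f` for which `f log f` is integrable, so that its
differential entropy is defined and finite. -/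
def HasFiniteDiffEntropy {n : ℕ} (μ : Measure (Fin n → ℝ)) : Prop :=
  μ ≪ volume ∧ Integrable (fun x => Real.negMulLog (lebesgueDensity μ x)) volume

/-- The differential entropy `-∫ f log f` of a law `μ` on `ℝⁿ` with density `f`, in nats. -/
def diffEntropy {n : ℕ} (μ : Measure (Fin n → ℝ)) : ℝ :=
  ∫ x, Real.negMulLog (lebesgueDensity μ x)

/-- The process `X` has differential entropy rate `h`: all joint differential entropies
`h(X 1, …, X n)` are defined and finite, and `h(X 1, …, X n) / n` tends to `h`. -/
def HasDiffEntropyRate {Ω : Type*} [MeasurableSpace Ω] (P : Measure Ω) (X : ℤ → Ω → ℝ)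
    (h : ℝ) : Prop :=
  (∀ n : ℕ, HasFiniteDiffEntropy (jointLaw P X n)) ∧
    Tendsto (fun n : ℕ => diffEntropy (jointLaw P X n) / n) atTop (𝓝 h)

end

/-! The chain rule for entropy reduces the rate to the limit of the one-step prediction error
variances. In `Lp ℝ 2 P`, apply Gram–Schmidt to the centred variables `Y 1, …, Y n`. The change of
basis is unitriangular, hence preserves Lebesgue measure, and the residuals are independent centred
normals because they are orthogonal in the Gaussian space of the noise
(`jointLaw_eq_map_pi_gaussianReal`). So the joint entropy is the sum of `1/2 * log (2πe ‖w k‖²)`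
over the residuals `w k`, and a Cesàro limit gives the rate as soon as `‖w k‖²` converges.

The limit is the noise variance `v` (`tendsto_norm_sq_gramSchmidt`). The truncated series of `(1 -
L) ^ d` is one admissible predictor, which bounds the error above; the current noise is orthogonal
to the past, which bounds it below by `v`. The lower bound needs the causal representation `Y = (1 -
L) ^ (-d) ε` (`hasSum_fracDiffCoeff_neg_smul`), where decay of the autocovariance is essential.

Finally `σ² = v ∑ c_k²` with `c_k` the coefficients of `(1 - z) ^ (-d)`, and this sum is `F(d, d; 1;
1) = Γ(1 - 2d) / Γ(1 - d)²` (`tsum_fracDiffCoeff_neg_sq`), which turns `v` into the stated Gamma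
factors. -/

/-! ### Binomial coefficients of `(1 - z) ^ a`: recursions, growth, and the sum of squares. -/

theorem fracDiffCoeff_zero_right (d : ℝ) : fracDiffCoeff d 0 = 1 := by
  simp [fracDiffCoeff]

theorem fracDiffCoeff_succ (d : ℝ) (k : ℕ) :
    (k + 1) * fracDiffCoeff d (k + 1) = (k - d) * fracDiffCoeff d k := by
  have h := Ring.choose_eq_smul (a := d) (n := k)
  have h1 := Ring.choose_eq_smul (a := d) (n := k + 1)
  have h2 : (descPochhammer ℤ (k + 1)).smeval d = (descPochhammer ℤ k).smeval d * (d - k) := by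
    rw [descPochhammer_succ_right, Polynomial.smeval_mul]
    simp [Polynomial.smeval_sub, Polynomial.smeval_natCast]
  have hk : (k.factorial : ℝ) ≠ 0 := by positivity
  unfold fracDiffCoeff
  rw [h, h1, h2, Nat.factorial_succ, pow_succ]
  simp only [smul_eq_mul]
  push_cast
  field_simp
  ring

/-- Chu–Vandermonde: the coefficient form of `(1 - z) ^ a * (1 - z) ^ b = (1 - z) ^ (a + b)`. -/
theorem sum_antidiagonal_fracDiffCoeff_mul (a b : ℝ) (n : ℕ) :
    ∑ p ∈ Finset.HasAntidiagonal.antidiagonal n, fracDiffCoeff a p.1 * fracDiffCoeff b p.2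
      = fracDiffCoeff (a + b) n := by
  unfold fracDiffCoeff
  rw [Ring.add_choose_eq n (Commute.all a b), Finset.mul_sum]
  refine Finset.sum_congr rfl fun p hp => ?_
  rw [← Finset.HasAntidiagonal.mem_antidiagonal.1 hp, pow_add]
  ring

theorem fracDiffCoeff_one_one : fracDiffCoeff 1 1 = -1 := by
  have := fracDiffCoeff_succ 1 0
  simpa [fracDiffCoeff_zero_right] using this

theorem fracDiffCoeff_one_add_two (k : ℕ) : fracDiffCoeff 1 (k + 2) = 0 := by
  induction k with
  | zero =>
    have := fracDiffCoeff_succ 1 1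
    norm_num at this
    exact this
  | succ k ih =>
    have := fracDiffCoeff_succ 1 (k + 2)
    rw [ih, mul_zero] at this
    exact (mul_eq_zero.1 this).resolve_left (by positivity)

theorem fracDiffCoeff_add_one (a : ℝ) (k : ℕ) :
    fracDiffCoeff (a + 1) (k + 1) = fracDiffCoeff a (k + 1) - fracDiffCoeff a k := by
  unfold fracDiffCoeff
  rw [Ring.choose_succ_succ, pow_succ]
  ring

theorem fracDiffCoeff_eq_prod (a : ℝ) (n : ℕ) :
    fracDiffCoeff a n = (∏ j ∈ Finset.range n, (-a + j)) / n.factorial := by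
  induction n with
  | zero => simp [fracDiffCoeff_zero_right]
  | succ n ih =>
    have h := fracDiffCoeff_succ a n
    have h1 : (n.factorial : ℝ) ≠ 0 := by positivity
    have h2 : (n + 1 : ℝ) ≠ 0 := by positivity
    rw [ih] at h
    rw [Finset.prod_range_succ, Nat.factorial_succ]
    push_cast
    field_simp at h ⊢
    linear_combination h

theorem fracDiffCoeff_succ_eq_inv_GammaSeq (a : ℝ) (n : ℕ) (hn : n ≠ 0) :
    fracDiffCoeff a (n + 1) = (Real.GammaSeq (-a) n)⁻¹ * ((n : ℝ) ^ (-a) / (n + 1)) := by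
  rw [fracDiffCoeff_eq_prod, Real.GammaSeq, Nat.factorial_succ]
  have h1 : (n.factorial : ℝ) ≠ 0 := by positivity
  have h2 : (n + 1 : ℝ) ≠ 0 := by positivity
  have h3 : (n : ℝ) ^ (-a) ≠ 0 := by positivity
  rw [inv_div]
  push_cast
  field_simp

theorem fracDiffCoeff_isBigO (a : ℝ) :
    (fun n => fracDiffCoeff a (n + 1)) =O[atTop] fun n : ℕ => (n : ℝ) ^ (-a - 1) := by
  -- `Real.Gamma` takes the value 0 at its poles, so this case means that `a` is a natural number
  -- `m`; the coefficients then vanish beyond index `m`.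
  by_cases hG : Real.Gamma (-a) = 0
  · obtain ⟨m, hm⟩ := (Real.Gamma_eq_zero_iff _).1 hG
    refine (Asymptotics.isBigO_refl _ _).congr' ?_ .rfl |>.trans (Asymptotics.isBigO_zero _ _)
    filter_upwards [eventually_ge_atTop m] with n hn
    rw [fracDiffCoeff_eq_prod, Finset.prod_eq_zero (i := m) (by simp; omega) (by linarith)]
    simp
  · have h := ((Real.GammaSeq_tendsto_Gamma (-a)).inv₀ hG).isBigO_one ℝ
    have h2 : (fun n : ℕ => (n : ℝ) ^ (-a) / (n + 1)) =O[atTop] fun n : ℕ => (n : ℝ) ^ (-a - 1) := by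
      refine Asymptotics.IsBigO.of_bound 1 ?_
      filter_upwards [eventually_ge_atTop 1] with n hn
      have hn' : (0 : ℝ) < n := by exact_mod_cast hn
      rw [Real.rpow_sub_one hn'.ne', one_mul, Real.norm_of_nonneg (by positivity),
        Real.norm_of_nonneg (by positivity)]
      gcongr
      linarith
    refine (h.mul h2).congr' ?_ (by simp)
    filter_upwards [eventually_ge_atTop 1] with n hn
    rw [fracDiffCoeff_succ_eq_inv_GammaSeq a n (by omega)]

/-- Used with `a = 1 - d`. For the inverse filter, `a = -d`, only square summability holds in
general, which is why the equation is inverted through first differences. -/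
theorem summable_abs_fracDiffCoeff {a : ℝ} (ha : 0 < a) :
    Summable fun k => |fracDiffCoeff a k| := by
  refine (summable_nat_add_iff 1).1 ?_
  exact (summable_of_isBigO_nat (Real.summable_nat_rpow.2 (by linarith : -a - 1 < -1))
    (fracDiffCoeff_isBigO a)).abs

theorem summable_fracDiffCoeff_sq {a : ℝ} (ha : -1 / 2 < a) :
    Summable fun k => fracDiffCoeff a k ^ 2 := by
  refine (summable_nat_add_iff 1).1 ?_
  refine summable_of_isBigO_nat (Real.summable_nat_rpow.2 (by linarith : 2 * (-a - 1) < -1)) ?_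
  refine ((fracDiffCoeff_isBigO a).pow 2).congr_right fun n => ?_
  rw [mul_comm, Real.rpow_mul (by positivity)]
  norm_cast

theorem tendsto_mul_fracDiffCoeff_sq {a : ℝ} (ha : -1 / 2 < a) :
    Tendsto (fun k : ℕ => (k : ℝ) * fracDiffCoeff a k ^ 2) atTop (𝓝 0) := by
  refine (tendsto_add_atTop_iff_nat 1).1 ?_
  have h1 : (fun n : ℕ => ((n + 1 : ℕ) : ℝ)) =O[atTop] fun n : ℕ => (n : ℝ) := by
    refine Asymptotics.IsBigO.of_bound 2 ?_
    filter_upwards [eventually_ge_atTop 1] with n hn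
    have hn' : (1 : ℝ) ≤ n := by exact_mod_cast hn
    simp only [Real.norm_natCast]
    push_cast
    linarith
  refine (h1.mul ((fracDiffCoeff_isBigO a).pow 2)).trans_tendsto ?_
  have h2 := (tendsto_rpow_neg_atTop (y := 1 + 2 * a) (by linarith)).comp
    tendsto_natCast_atTop_atTop
  refine h2.congr' ?_
  filter_upwards [eventually_ge_atTop 1] with n hn
  have hn' : (0 : ℝ) < n := by exact_mod_cast hn
  have : (-(1 + 2 * a)) = 1 + (-a - 1) * 2 := by ring
  simp only [Function.comp]
  rw [this, Real.rpow_add hn', Real.rpow_one, Real.rpow_mul hn'.le]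
  norm_cast

theorem summable_fracDiffCoeff_sq_div_choose {a : ℝ} (ha : -1 / 2 < a) (m : ℕ) :
    Summable fun k => fracDiffCoeff a k ^ 2 / ((m + k).choose k : ℝ) := by
  refine (summable_fracDiffCoeff_sq ha).of_nonneg_of_le (fun k => by positivity) fun k => ?_
  refine div_le_self (by positivity) ?_
  exact_mod_cast Nat.choose_pos (by omega)

/-- One step of Gauss's contiguity relation for `F(d, d; m + 1; 1)`. -/
theorem tsum_fracDiffCoeff_sq_div_choose_succ {d : ℝ} (hd : d < 1 / 2) (m : ℕ) :
    (m + 1) * (m + 1 - 2 * d) * ∑' k, fracDiffCoeff (-d) k ^ 2 / ((m + k).choose k : ℝ)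
      = (m + 1 - d) ^ 2 * ∑' k, fracDiffCoeff (-d) k ^ 2 / ((m + 1 + k).choose k : ℝ) := by
  have hd' : -1 / 2 < -d := by linarith
  have hs := (summable_fracDiffCoeff_sq_div_choose hd' m).hasSum
  have hs' := (summable_fracDiffCoeff_sq_div_choose hd' (m + 1)).hasSum
  set t : ℕ → ℝ := fun k => fracDiffCoeff (-d) k ^ 2 / ((m + k).choose k : ℝ) with ht
  set t' : ℕ → ℝ := fun k => fracDiffCoeff (-d) k ^ 2 / ((m + 1 + k).choose k : ℝ) with ht'
  have hpos : ∀ p k : ℕ, ((p + k).choose k : ℝ) ≠ 0 := fun p k =>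
    Nat.cast_ne_zero.2 (Nat.choose_pos (by omega)).ne'
  have h1 : ∀ k : ℕ, t' k * (m + 1 + k) = t k * (m + 1) := by
    intro k
    have h := Nat.choose_mul_succ_eq (m + k) k
    rw [show m + k + 1 - k = m + 1 by omega, show m + k + 1 = m + 1 + k by omega] at h
    have h : ((m + k).choose k : ℝ) * (m + 1 + k) = (m + 1 + k).choose k * (m + 1) := by
      exact_mod_cast h
    have := hpos m k
    have := hpos (m + 1) k
    simp only [ht, ht']
    field_simp
    linear_combination fracDiffCoeff (-d) k ^ 2 * h
  have h2 : ∀ k : ℕ, t (k + 1) * (k + 1) * (m + 1 + k) = t k * (d + k) ^ 2 := by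
    intro k
    have h := Nat.add_one_mul_choose_eq (m + k) k
    rw [show m + k + 1 = m + (k + 1) by omega] at h
    have h : (m + (k + 1)) * ((m + k).choose k : ℝ) = (m + (k + 1)).choose (k + 1) * (k + 1) := by
      exact_mod_cast h
    have hf := fracDiffCoeff_succ (-d) k
    have := hpos m k
    have := hpos m (k + 1)
    have hk : (k + 1 : ℝ) ≠ 0 := by positivity
    have hf : fracDiffCoeff (-d) (k + 1) = (k + d) * fracDiffCoeff (-d) k / (k + 1) := by
      field_simp
      linear_combination hf
    simp only [ht]
    rw [hf]
    field_simp
    linear_combination (k + d) ^ 2 * fracDiffCoeff (-d) k ^ 2 * h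
  -- The combination telescopes with certificate `(m + 1) * k * t k`. The boundary term vanishes in
  -- the limit because `k * c_k² → 0` for `d < 1/2`.
  have h3 : ∀ N : ℕ, ∑ k ∈ Finset.range N,
      ((m + 1) * (m + 1 - 2 * d) * t k - (m + 1 - d) ^ 2 * t' k) = - ((m + 1) * (N * t N)) := by
    intro N
    induction N with
    | zero => simp
    | succ N ih =>
      rw [Finset.sum_range_succ, ih]
      have hN : (m + 1 + N : ℝ) ≠ 0 := by positivity
      apply mul_right_cancel₀ hN
      push_cast
      linear_combination (m + 1 : ℝ) * h2 N - (m + 1 - d) ^ 2 * h1 N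
  have h4 : Tendsto (fun N : ℕ => -((m + 1) * (N * t N))) atTop (𝓝 0) := by
    have h5 : Tendsto (fun N : ℕ => (N : ℝ) * t N) atTop (𝓝 0) := by
      refine squeeze_zero (fun N => by positivity) (fun N => ?_)
        (tendsto_mul_fracDiffCoeff_sq hd')
      gcongr
      refine div_le_self (by positivity) ?_
      exact_mod_cast Nat.choose_pos (by omega)
    simpa using (h5.const_mul ((m : ℝ) + 1)).neg
  have h6 := ((hs.mul_left ((m + 1) * (m + 1 - 2 * d))).sub
    (hs'.mul_left ((m + 1 - d) ^ 2))).tendsto_sum_nat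
  simp only [h3] at h6
  exact sub_eq_zero.1 (tendsto_nhds_unique h6 h4)

/-- For `k ≥ 1` the binomial coefficient is at least `m + 1`, so only the term `k = 0` survives; the
squares themselves dominate. -/
theorem tendsto_tsum_fracDiffCoeff_sq_div_choose {d : ℝ} (hd : d < 1 / 2) :
    Tendsto (fun m : ℕ => ∑' k, fracDiffCoeff (-d) k ^ 2 / ((m + k).choose k : ℝ)) atTop (𝓝 1) := by
  have h1 : ∑' k : ℕ, (if k = 0 then (1 : ℝ) else 0) = 1 := tsum_ite_eq 0 1
  rw [← h1]
  refine tendsto_tsum_of_dominated_convergence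
    (summable_fracDiffCoeff_sq (show -1 / 2 < -d by linarith)) (fun k => ?_)
    (Eventually.of_forall fun m k => ?_)
  · rcases k with _ | k
    · simp [fracDiffCoeff_zero_right]
    · simp only [Nat.add_eq_zero_iff, one_ne_zero, and_false, if_false]
      refine squeeze_zero (fun m => by positivity) (fun m => ?_)
        (tendsto_const_div_atTop_nhds_zero_nat (fracDiffCoeff (-d) (k + 1) ^ 2) |>.comp
          (tendsto_add_atTop_nat 1))
      simp only [Function.comp]
      gcongr
      rw [← add_assoc, Nat.choose_symm_of_eq_add (show m + k + 1 = (k + 1) + m by omega)]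
      calc m + 1 = (m + 1).choose m := by simp
        _ ≤ (m + k + 1).choose m := Nat.choose_le_choose _ (by omega)
  · rw [Real.norm_of_nonneg (by positivity)]
    refine div_le_self (by positivity) ?_
    exact_mod_cast Nat.choose_pos (by omega)

/-- Gauss's summation of `F(d, d; 1; 1)`: iterating the contiguity relation expresses the sum as a
finite product times a factor tending to 1, and the product is a ratio of Euler's approximations
`Real.GammaSeq`. -/
theorem tsum_fracDiffCoeff_neg_sq {d : ℝ} (hd : d < 1 / 2) :
    ∑' k, fracDiffCoeff (-d) k ^ 2 = Real.Gamma (1 - 2 * d) / Real.Gamma (1 - d) ^ 2 := by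
  set F : ℕ → ℝ := fun m => ∑' k, fracDiffCoeff (-d) k ^ 2 / ((m + k).choose k : ℝ) with hF
  have hF0 : F 0 = ∑' k, fracDiffCoeff (-d) k ^ 2 := by simp [hF]
  have hG : Real.Gamma (1 - d) ≠ 0 := (Real.Gamma_pos_of_pos (by linarith)).ne'
  have h1 : ∀ n : ℕ, n ≠ 0 → F 0 = Real.GammaSeq 1 n * Real.GammaSeq (1 - 2 * d) n
      / Real.GammaSeq (1 - d) n ^ 2 * F (n + 1) := by
    have h2 : ∀ M : ℕ, (∏ j ∈ Finset.range M, (1 + (j : ℝ))) *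
        (∏ j ∈ Finset.range M, (1 - 2 * d + (j : ℝ))) * F 0
        = (∏ j ∈ Finset.range M, (1 - d + (j : ℝ))) ^ 2 * F M := by
      intro M
      induction M with
      | zero => simp
      | succ M ih =>
        have h := tsum_fracDiffCoeff_sq_div_choose_succ hd M
        change _ * F M = _ * F (M + 1) at h
        simp only [Finset.prod_range_succ]
        linear_combination (1 + (M : ℝ)) * (1 - 2 * d + M) * ih
          + (∏ j ∈ Finset.range M, (1 - d + (j : ℝ))) ^ 2 * h
    intro n hn
    have h3 := h2 (n + 1)
    have hp : ∀ s : ℝ, 0 < s → ∏ j ∈ Finset.range (n + 1), (s + (j : ℝ)) ≠ 0 := fun s hs =>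
      Finset.prod_ne_zero_iff.2 fun j _ => by positivity
    have hp1 := hp 1 one_pos
    have hp2 := hp (1 - 2 * d) (by linarith)
    have hp3 := hp (1 - d) (by linarith)
    have hn' : (0 : ℝ) < n := by exact_mod_cast Nat.pos_of_ne_zero hn
    -- The powers of `n` in the three Euler products cancel, since `1 + (1 - 2d) = 2(1 - d)`.
    have hr : (n : ℝ) ^ (1 : ℝ) * (n : ℝ) ^ (1 - 2 * d) = ((n : ℝ) ^ (1 - d)) ^ 2 := by
      rw [← Real.rpow_add hn', ← Real.rpow_natCast, ← Real.rpow_mul hn'.le]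
      congr 1
      push_cast
      ring
    have hr3 : (n : ℝ) ^ (1 - d) ≠ 0 := by positivity
    have hfac : (n.factorial : ℝ) ≠ 0 := by positivity
    simp only [Real.GammaSeq]
    generalize (n : ℝ) ^ (1 : ℝ) = x at *
    field_simp
    rw [hr]
    field_simp
    linear_combination h3
  have h4 : Tendsto (fun n : ℕ => Real.GammaSeq 1 n * Real.GammaSeq (1 - 2 * d) n
      / Real.GammaSeq (1 - d) n ^ 2 * F (n + 1)) atTop
      (𝓝 (Real.Gamma 1 * Real.Gamma (1 - 2 * d) / Real.Gamma (1 - d) ^ 2 * 1)) :=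
    (((Real.GammaSeq_tendsto_Gamma 1).mul (Real.GammaSeq_tendsto_Gamma _)).div
      ((Real.GammaSeq_tendsto_Gamma _).pow 2) (by positivity)).mul
      ((tendsto_tsum_fracDiffCoeff_sq_div_choose hd).comp (tendsto_add_atTop_nat 1))
  rw [← hF0]
  refine tendsto_nhds_unique (tendsto_const_nhds.congr' ?_) (h4.trans (by simp))
  filter_upwards [eventually_ge_atTop 1] with n hn
  exact h1 n (by omega)

/-! ### Moving averages of orthogonal vectors in a Hilbert space. -/

section OrthogonalNoise

variable {E : Type*} [NormedAddCommGroup E] [InnerProductSpace ℝ E]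

/-- The case `v = 0` is allowed, so the vectors cannot be normalised; the lines they span serve as
the orthogonal family instead. -/
theorem summable_smul_of_orthogonal [CompleteSpace E] {u : ℕ → E} {v : ℝ}
    (hu : ∀ i j, inner ℝ (u i) (u j) = if i = j then v else 0)
    {a : ℕ → ℝ} (ha : Summable fun k => a k ^ 2) : Summable fun k => a k • u k := by
  have hV : OrthogonalFamily ℝ (fun k => (ℝ ∙ u k)) fun k => (ℝ ∙ u k).subtypeₗᵢ := by
    refine OrthogonalFamily.of_pairwise fun i j hij => ?_
    rw [Function.onFun, Submodule.isOrtho_span]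
    simp [hu, hij]
  have h := hV.summable_iff_norm_sq_summable
    (fun k => ⟨a k • u k, Submodule.smul_mem _ _ (Submodule.mem_span_singleton_self _)⟩)
  refine h.2 ?_
  simp only [Submodule.coe_norm, norm_smul, mul_pow]
  have h2 : ∀ k, ‖u k‖ ^ 2 = v := fun k => by rw [← real_inner_self_eq_norm_sq, hu, if_pos rfl]
  simpa [h2] using ha.mul_right v

theorem inner_eq_of_hasSum_of_orthogonal {u : ℕ → E} {v : ℝ}
    (hu : ∀ i j, inner ℝ (u i) (u j) = if i = j then v else 0)
    {a : ℕ → ℝ} {x : E} (hx : HasSum (fun k => a k • u k) x) (i : ℕ) :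
    inner ℝ x (u i) = a i * v := by
  have h := hx.mapL (innerSL ℝ (u i))
  have h2 : HasSum (fun k => if k = i then a i * v else 0) (a i * v) := hasSum_ite_eq i _
  rw [real_inner_comm]
  refine h.unique (h2.congr_fun fun k => ?_)
  simp only [innerSL_apply_apply, inner_smul_right, hu, eq_comm (a := i)]
  split_ifs with hk <;> simp [hk]

theorem norm_sq_hasSum_of_orthogonal {u : ℕ → E} {v : ℝ}
    (hu : ∀ i j, inner ℝ (u i) (u j) = if i = j then v else 0)
    {a : ℕ → ℝ} {x : E} (hx : HasSum (fun k => a k • u k) x) :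
    HasSum (fun k => a k ^ 2 * v) (‖x‖ ^ 2) := by
  have h := hx.mapL (innerSL ℝ x)
  simp only [innerSL_apply_apply, inner_smul_right, inner_eq_of_hasSum_of_orthogonal hu hx,
    real_inner_self_eq_norm_sq] at h
  exact h.congr_fun fun k => by ring

/-- The shifts of a square summable moving average tend weakly to zero. -/
theorem tendsto_inner_movingAverage {ε Z : ℤ → E} {v : ℝ}
    (hε : ∀ i j, inner ℝ (ε i) (ε j) = if i = j then v else 0)
    {a : ℕ → ℝ} (hZ : ∀ n, HasSum (fun k : ℕ => a k • ε (n - k)) (Z n)) (x : E) :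
    Tendsto (fun n : ℕ => inner ℝ x (Z n)) atTop (𝓝 0) := by
  have hu : ∀ n : ℤ, ∀ i j : ℕ, inner ℝ (ε (n - i)) (ε (n - j)) = if i = j then v else 0 := by
    intro n i j
    rw [hε]
    congr 1
    simp
  have hε0 : ∀ i, ‖ε i‖ ^ 2 = v := fun i => by rw [← real_inner_self_eq_norm_sq, hε, if_pos rfl]
  -- Bessel's inequality for the normalised noise.
  have hx : Tendsto (fun n : ℕ => inner ℝ x (ε n)) atTop (𝓝 0) := by
    rcases eq_or_ne v 0 with hv | hv
    · have : ∀ i, ε i = 0 := fun i => by simpa [hv] using hε0 i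
      simp [this]
    · have hv' : 0 < v := lt_of_le_of_ne (hε0 0 ▸ by positivity) hv.symm
      have hs : √v ≠ 0 := by positivity
      have ho : Orthonormal ℝ fun n : ℕ => (√v)⁻¹ • ε n := by
        rw [orthonormal_iff_ite]
        intro i j
        rw [inner_smul_left, inner_smul_right, hε]
        simp only [Nat.cast_inj, conj_trivial]
        split_ifs
        · rw [← mul_assoc, ← mul_inv, Real.mul_self_sqrt hv'.le, inv_mul_cancel₀ hv]
        · simp
      have h := (ho.inner_products_summable x).tendsto_atTop_zero
      have h1 : Tendsto (fun n : ℕ => ‖inner ℝ ((√v)⁻¹ • ε n) x‖) atTop (𝓝 0) := by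
        simpa [Real.sqrt_sq_eq_abs] using h.sqrt
      have h2 := (tendsto_zero_iff_norm_tendsto_zero.2 h1).const_mul √v
      simp only [inner_smul_left, conj_trivial, mul_inv_cancel_left₀ hs, mul_zero] at h2
      simpa only [real_inner_comm] using h2
  -- The truncation error does not depend on `n`, so a single `M` serves all times and only finite
  -- moving averages remain.
  have htail : ∀ n : ℤ, ∀ M : ℕ, ‖Z n - ∑ k ∈ Finset.range M, a k • ε (n - k)‖ ^ 2
      = ‖Z 0 - ∑ k ∈ Finset.range M, a k • ε (0 - k)‖ ^ 2 := by
    have key : ∀ n : ℤ, ∀ M : ℕ, HasSum (fun k => a (k + M) ^ 2 * v)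
        (‖Z n - ∑ k ∈ Finset.range M, a k • ε (n - k)‖ ^ 2) := by
      intro n M
      refine norm_sq_hasSum_of_orthogonal (u := fun k : ℕ => ε (n - (k + M : ℕ)))
        (fun i j => ?_) ((hasSum_nat_add_iff' M).2 (hZ n))
      rw [hu]
      simp
    exact fun n M => (key n M).unique (key 0 M)
  have hpart : ∀ M : ℕ, Tendsto
      (fun n : ℕ => inner ℝ x (∑ k ∈ Finset.range M, a k • ε (n - k))) atTop (𝓝 0) := by
    intro M
    simp only [inner_sum, inner_smul_right]
    rw [← Finset.sum_const_zero (s := Finset.range M)]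
    refine tendsto_finsetSum _ fun k _ => ?_
    rw [← mul_zero (a k)]
    refine Tendsto.const_mul _ ?_
    rw [← tendsto_add_atTop_iff_nat k]
    simpa using hx
  have h0 : Tendsto (fun M : ℕ => ‖x‖ * ‖Z 0 - ∑ k ∈ Finset.range M, a k • ε (0 - k)‖)
      atTop (𝓝 0) := by
    have := ((hZ 0).tendsto_sum_nat.const_sub (Z 0)).norm.const_mul ‖x‖
    simpa using this
  rw [Metric.tendsto_atTop]
  intro δ hδ
  obtain ⟨M, hM⟩ := ((tendsto_order.1 h0).2 (δ / 2) (by positivity)).exists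
  obtain ⟨N, hN⟩ := Metric.tendsto_atTop.1 (hpart M) (δ / 2) (by positivity)
  refine ⟨N, fun n hn => ?_⟩
  have h1 := hN n hn
  have h2 : inner ℝ x (Z n) = inner ℝ x (Z n - ∑ k ∈ Finset.range M, a k • ε (n - k))
      + inner ℝ x (∑ k ∈ Finset.range M, a k • ε (n - k)) := by rw [← inner_add_right]; simp
  have h3 := abs_real_inner_le_norm x (Z n - ∑ k ∈ Finset.range M, a k • ε (n - k))
  rw [(sq_eq_sq₀ (norm_nonneg _) (norm_nonneg _)).1 (htail n M)] at h3
  rw [Real.dist_eq, sub_zero] at h1 ⊢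
  rw [h2]
  exact (abs_add_le _ _).trans_lt (by linarith)

end OrthogonalNoise

/-! ### Inverting `(1 - L) ^ d` on stationary sequences. -/

section FractionalNoise

variable {E : Type*} [NormedAddCommGroup E] [InnerProductSpace ℝ E]

theorem norm_sum_smul_of_stationary {Y : ℤ → E}
    (hst : ∀ m n k, inner ℝ (Y (m + k)) (Y (n + k)) = inner ℝ (Y m) (Y n)) (c : ℕ → ℝ)
    (n : ℤ) (N : ℕ) : ‖∑ k ∈ Finset.range N, c k • Y (n - k)‖
      = ‖∑ k ∈ Finset.range N, c k • Y (0 - k)‖ := by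
  rw [← sq_eq_sq₀ (norm_nonneg _) (norm_nonneg _)]
  simp only [← real_inner_self_eq_norm_sq, sum_inner, inner_sum, inner_smul_left,
    inner_smul_right]
  refine Finset.sum_congr rfl fun i _ => ?_
  congr 1
  refine Finset.sum_congr rfl fun j _ => ?_
  have := hst (0 - j) (0 - i) n
  rw [← this]
  ring_nf

/-- Exact finite form of `(1 - L) ^ (1 - d) (1 - L) ^ d = 1 - L`: truncating to the triangle `j + k
< N` leaves no remainder once both nonzero coefficients of `1 - z` are included. -/
theorem sum_fracDiffCoeff_smul_sum_fracDiffCoeff_smul (Y : ℤ → E) (d : ℝ) (n : ℤ) {N : ℕ}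
    (hN : 2 ≤ N) :
    ∑ j ∈ Finset.range N, fracDiffCoeff (1 - d) j •
      ∑ k ∈ Finset.range (N - j), fracDiffCoeff d k • Y (n - j - k) = Y n - Y (n - 1) := by
  simp only [Finset.smul_sum]
  rw [← Finset.sum_range_diag_flip N
    (fun j k => fracDiffCoeff (1 - d) j • fracDiffCoeff d k • Y (n - j - k))]
  have h : ∀ m : ℕ, ∑ k ∈ Finset.range (m + 1), fracDiffCoeff (1 - d) k •
      fracDiffCoeff d (m - k) • Y (n - k - (m - k : ℕ)) = fracDiffCoeff 1 m • Y (n - m) := by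
    intro m
    have h1 := sum_antidiagonal_fracDiffCoeff_mul (1 - d) d m
    rw [sub_add_cancel, Finset.Nat.sum_antidiagonal_eq_sum_range_succ
      (fun i j => fracDiffCoeff (1 - d) i * fracDiffCoeff d j)] at h1
    rw [← h1, Finset.sum_smul]
    refine Finset.sum_congr rfl fun k hk => ?_
    have hk' : k ≤ m := Nat.lt_succ_iff.1 (Finset.mem_range.1 hk)
    rw [smul_smul, Nat.cast_sub hk']
    congr 2
    ring
  simp only [h]
  obtain ⟨N, rfl⟩ := Nat.exists_eq_add_of_le hN
  rw [add_comm, Finset.sum_range_succ', Finset.sum_range_succ']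
  simp [fracDiffCoeff_one_add_two, fracDiffCoeff_one_one, fracDiffCoeff_zero_right, add_assoc,
    one_add_one_eq_two]
  abel

variable {Y ε : ℤ → E} {d v : ℝ}

/-- Let `N → ∞` in the triangular identity by dominated convergence: the outer coefficients are
absolutely summable, and stationarity bounds the inner partial sums uniformly in time. -/
theorem hasSum_fracDiffCoeff_one_sub_smul [CompleteSpace E] (hd : d < 1)
    (hst : ∀ m n k, inner ℝ (Y (m + k)) (Y (n + k)) = inner ℝ (Y m) (Y n))
    (heq : ∀ n, Tendsto (fun N : ℕ => ∑ k ∈ Finset.range N, fracDiffCoeff d k • Y (n - k))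
      atTop (𝓝 (ε n)))
    (hsum : ∀ n, Summable (fun j : ℕ => fracDiffCoeff (1 - d) j • ε (n - j))) (n : ℤ) :
    HasSum (fun j : ℕ => fracDiffCoeff (1 - d) j • ε (n - j)) (Y n - Y (n - 1)) := by
  obtain ⟨C, hC⟩ : ∃ C, ∀ N : ℕ,
      ‖∑ k ∈ Finset.range N, fracDiffCoeff d k • Y (0 - k)‖ ≤ C := by
    obtain ⟨C, hC⟩ := (heq 0).norm.bddAbove_range
    exact ⟨C, fun N => hC ⟨N, rfl⟩⟩
  have h := tendsto_tsum_of_dominated_convergence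
    (f := fun (N j : ℕ) => if j < N then fracDiffCoeff (1 - d) j •
      ∑ k ∈ Finset.range (N - j), fracDiffCoeff d k • Y (n - j - k) else 0)
    (g := fun j : ℕ => fracDiffCoeff (1 - d) j • ε (n - j))
    (bound := fun j => |fracDiffCoeff (1 - d) j| * C) (𝓕 := atTop)
    ((summable_abs_fracDiffCoeff (by linarith)).mul_right C) (fun j => ?_)
    (Eventually.of_forall fun N j => ?_)
  · have h2 : ∀ᶠ N : ℕ in atTop, ∑' j : ℕ, (if j < N then fracDiffCoeff (1 - d) j •
        ∑ k ∈ Finset.range (N - j), fracDiffCoeff d k • Y (n - j - k) else 0)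
        = Y n - Y (n - 1) := by
      filter_upwards [eventually_ge_atTop 2] with N hN
      rw [tsum_eq_sum (s := Finset.range N) (fun j hj => if_neg (by simpa using hj)),
        ← sum_fracDiffCoeff_smul_sum_fracDiffCoeff_smul Y d n hN]
      exact Finset.sum_congr rfl fun j hj => if_pos (Finset.mem_range.1 hj)
    rw [tendsto_nhds_unique (tendsto_const_nhds.congr' (h2.mono fun _ h => h.symm)) h]
    exact (hsum n).hasSum
  · have h1 := ((heq (n - j)).comp (tendsto_sub_atTop_nat j)).const_smul (fracDiffCoeff (1 - d) j)
    refine h1.congr' ?_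
    filter_upwards [eventually_gt_atTop j] with N hN
    simp [hN]
  · split_ifs
    · rw [norm_smul, Real.norm_eq_abs, norm_sum_smul_of_stationary hst]
      gcongr
      exact hC _
    · have := (norm_nonneg _).trans (hC 0)
      simpa using by positivity

/-- A stationary solution of `(1 - L) ^ d Y = ε` with decaying autocovariance is the moving
average `(1 - L) ^ (-d) ε`. -/
theorem hasSum_fracDiffCoeff_neg_smul [CompleteSpace E] (hd : d < 1 / 2)
    (hε : ∀ i j, inner ℝ (ε i) (ε j) = if i = j then v else 0)
    (hst : ∀ m n k, inner ℝ (Y (m + k)) (Y (n + k)) = inner ℝ (Y m) (Y n))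
    (hdecay : Tendsto (fun k : ℕ => inner ℝ (Y 0) (Y k)) atTop (𝓝 0))
    (heq : ∀ n, Tendsto (fun N : ℕ => ∑ k ∈ Finset.range N, fracDiffCoeff d k • Y (n - k))
      atTop (𝓝 (ε n))) (n : ℤ) :
    HasSum (fun j : ℕ => fracDiffCoeff (-d) j • ε (n - j)) (Y n) := by
  have hu : ∀ n : ℤ, ∀ i j : ℕ, inner ℝ (ε (n - i)) (ε (n - j)) = if i = j then v else 0 := by
    intro n i j
    rw [hε]
    congr 1
    simp
  have hsum : ∀ a, -1 / 2 < a → ∀ n : ℤ,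
      Summable (fun j : ℕ => fracDiffCoeff a j • ε (n - j)) := fun a ha n =>
    summable_smul_of_orthogonal (hu n) (summable_fracDiffCoeff_sq ha)
  set Z : ℤ → E := fun n => ∑' j : ℕ, fracDiffCoeff (-d) j • ε (n - j) with hZdef
  have hZ : ∀ n, HasSum (fun j : ℕ => fracDiffCoeff (-d) j • ε (n - j)) (Z n) := fun n =>
    (hsum (-d) (by linarith) n).hasSum
  -- Both sides are `(1 - L) ^ (1 - d) ε`; for `Z` this is Pascal's rule `fracDiffCoeff_add_one`
  -- after splitting off the term of index 0.
  have hdiff : ∀ n, Z n - Z (n - 1) = Y n - Y (n - 1) := by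
    intro n
    have h1 := hasSum_fracDiffCoeff_one_sub_smul (by linarith) hst heq
      (hsum (1 - d) (by linarith)) n
    have h2 := (hasSum_nat_add_iff' 1).2 (hZ n)
    have h3 := (hasSum_nat_add_iff' 1).2 h1
    have h4 := h2.sub (hZ (n - 1))
    have h5 := h4.unique (h3.congr_fun fun k => ?_)
    · simp only [Finset.range_one, Finset.sum_singleton, fracDiffCoeff_zero_right] at h5
      rw [sub_right_comm] at h5
      simpa using h5
    · rw [show (1 - d) = -d + 1 by ring, fracDiffCoeff_add_one, sub_smul]
      congr 3
      push_cast
      ring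
  have hconst : ∀ n, Y n - Z n = Y 0 - Z 0 := by
    have hstep : ∀ n, Y n - Z n = Y (n - 1) - Z (n - 1) := fun n =>
      sub_eq_sub_iff_sub_eq_sub.1 (hdiff n).symm
    intro n
    induction n using Int.induction_on with
    | zero => rfl
    | succ n ih => rw [hstep, ← ih]; simp
    | pred n ih => rw [← ih, hstep (-n)]
  set W := Y 0 - Z 0 with hW
  have hY : ∀ n, Y n = Z n + W := fun n => by rw [← hconst n]; abel
  have hlim : ∀ x, Tendsto (fun n : ℕ => inner ℝ x (Y n)) atTop (𝓝 (inner ℝ x W)) := by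
    intro x
    have := (tendsto_inner_movingAverage hε hZ x).add_const (inner ℝ x W)
    simpa [hY, inner_add_right] using this
  -- `Y k` tends weakly to `W`, while by stationarity and decay its inner product with each fixed `Y
  -- n` tends to 0. Testing the weak limit against `W` itself then gives `⟪W, W⟫ = 0`.
  have hYW : ∀ n : ℕ, inner ℝ (Y n) W = 0 := by
    intro n
    refine tendsto_nhds_unique (hlim (Y n)) ?_
    rw [← tendsto_add_atTop_iff_nat n]
    refine hdecay.congr fun k => ?_
    rw [← hst 0 k n]
    simp
  have hW0 : W = 0 := by
    have h := hlim W
    simp only [real_inner_comm, hYW] at h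
    exact inner_self_eq_zero.1 (tendsto_nhds_unique h tendsto_const_nhds)
  rw [hY n, hW0, add_zero]
  exact hZ n

end FractionalNoise

/-! ### One-step prediction errors as Gram–Schmidt residuals. -/

section Innovations

variable {E : Type*} [NormedAddCommGroup E] [InnerProductSpace ℝ E]

open InnerProductSpace in
theorem inner_gramSchmidt_eq_zero_of_mem_span {ι : Type*} [LinearOrder ι] [LocallyFiniteOrderBot ι]
    [WellFoundedLT ι] (f : ι → E) (k : ι) {w : E}
    (hw : w ∈ Submodule.span ℝ (f '' Set.Iio k)) : inner ℝ (gramSchmidt ℝ f k) w = 0 := by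
  rw [← span_gramSchmidt_Iio] at hw
  induction hw using Submodule.span_induction with
  | mem x hx =>
    obtain ⟨i, hi, rfl⟩ := hx
    exact gramSchmidt_orthogonal ℝ f (ne_of_gt hi)
  | zero => simp
  | add x y _ _ hx hy => rw [inner_add_right, hx, hy, add_zero]
  | smul a x _ hx => rw [inner_smul_right, hx, mul_zero]

open InnerProductSpace in
theorem self_sub_gramSchmidt_mem_span {ι : Type*} [LinearOrder ι] [LocallyFiniteOrderBot ι]
    [WellFoundedLT ι] (f : ι → E) (k : ι) :
    f k - gramSchmidt ℝ f k ∈ Submodule.span ℝ (f '' Set.Iio k) := by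
  rw [← span_gramSchmidt_Iio ℝ f k]
  nth_rewrite 1 [gramSchmidt_def'' ℝ f k]
  rw [add_sub_cancel_left]
  exact Submodule.sum_mem _ fun i hi => Submodule.smul_mem _ _
    (Submodule.subset_span ⟨i, Finset.mem_Iio.1 hi, rfl⟩)

-- The residual is orthogonal to the span of the earlier vectors, hence is the shortest vector in
-- the coset of `f k`.
open InnerProductSpace in
theorem norm_gramSchmidt_le {ι : Type*} [LinearOrder ι] [LocallyFiniteOrderBot ι]
    [WellFoundedLT ι] (f : ι → E) (k : ι) {w : E}
    (hw : w ∈ Submodule.span ℝ (f '' Set.Iio k)) :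
    ‖gramSchmidt ℝ f k‖ ≤ ‖f k + w‖ := by
  have h : inner ℝ (gramSchmidt ℝ f k) (f k + w) = ‖gramSchmidt ℝ f k‖ ^ 2 := by
    have h1 := inner_gramSchmidt_eq_zero_of_mem_span f k (self_sub_gramSchmidt_mem_span f k)
    rw [inner_sub_right, sub_eq_zero, real_inner_self_eq_norm_sq] at h1
    rw [inner_add_right, inner_gramSchmidt_eq_zero_of_mem_span f k hw, h1, add_zero]
  have h2 := real_inner_le_norm (gramSchmidt ℝ f k) (f k + w)
  rw [h, sq] at h2
  rcases (norm_nonneg (gramSchmidt ℝ f k)).eq_or_lt with h0 | h0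
  · rw [← h0]; positivity
  · exact le_of_mul_le_mul_left h2 h0

variable {Y ε : ℤ → E} {d v : ℝ}

-- The noise `ε (k + 1)` is orthogonal to `Y 1, …, Y k` and has inner product `v` with `Y (k + 1)`,
-- hence also with the residual. Cauchy–Schwarz gives `v² ≤ v * ‖residual‖²`.
open InnerProductSpace in
theorem le_norm_sq_gramSchmidt (hv : 0 < v)
    (hε : ∀ i j, inner ℝ (ε i) (ε j) = if i = j then v else 0)
    {a : ℕ → ℝ} (ha : a 0 = 1) (hY : ∀ n, HasSum (fun j : ℕ => a j • ε (n - j)) (Y n)) (k : ℕ) :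
    v ≤ ‖gramSchmidt ℝ (fun i : ℕ => Y (i + 1)) k‖ ^ 2 := by
  have hinner : ∀ m n : ℤ, HasSum (fun j : ℕ => a j * if n = m - j then v else 0)
      (inner ℝ (ε n) (Y m)) := by
    intro m n
    have h := (hY m).mapL (innerSL ℝ (ε n))
    simpa only [innerSL_apply_apply, inner_smul_right, hε] using h
  have hlt : ∀ m n : ℤ, m < n → inner ℝ (ε n) (Y m) = 0 := by
    intro m n hmn
    refine (hinner m n).unique (hasSum_zero.congr_fun fun j => ?_)
    rw [if_neg (by omega), mul_zero]
  have heq : ∀ n : ℤ, inner ℝ (ε n) (Y n) = v := by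
    intro n
    refine (hinner n n).unique ((hasSum_ite_eq 0 v).congr_fun fun j => ?_)
    rcases j with _ | j
    · simp [ha]
    · rw [if_neg (by push_cast; omega)]; simp
  set f : ℕ → E := fun i => Y (i + 1) with hf
  have h0 : ∀ w ∈ Submodule.span ℝ (f '' Set.Iio k), inner ℝ (ε (k + 1)) w = 0 := by
    intro w hw
    induction hw using Submodule.span_induction with
    | mem x hx =>
      obtain ⟨i, hi, rfl⟩ := hx
      have hi : i < k := hi
      exact hlt _ _ (by omega)
    | zero => simp
    | add x y _ _ hx hy => rw [inner_add_right, hx, hy, add_zero]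
    | smul a x _ hx => rw [inner_smul_right, hx, mul_zero]
  have h1 := h0 _ (self_sub_gramSchmidt_mem_span f k)
  rw [inner_sub_right, sub_eq_zero, heq] at h1
  have h2 := real_inner_mul_inner_self_le (ε (k + 1)) (gramSchmidt ℝ f k)
  rw [← h1, hε, if_pos rfl, real_inner_self_eq_norm_sq] at h2
  exact le_of_mul_le_mul_left h2 hv

-- The truncated autoregression is a competitor for the best linear predictor, and stationarity
-- moves it to time 0.
open InnerProductSpace in
theorem norm_gramSchmidt_le_norm_sum
    (hst : ∀ m n k, inner ℝ (Y (m + k)) (Y (n + k)) = inner ℝ (Y m) (Y n))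
    {c : ℕ → ℝ} (hc : c 0 = 1) (k : ℕ) :
    ‖gramSchmidt ℝ (fun i : ℕ => Y (i + 1)) k‖
      ≤ ‖∑ j ∈ Finset.range (k + 1), c j • Y (0 - j)‖ := by
  rw [← norm_sum_smul_of_stationary hst c (k + 1) (k + 1), Finset.sum_range_succ', add_comm]
  simp only [hc, Nat.cast_zero, sub_zero, one_smul]
  refine norm_gramSchmidt_le (fun i : ℕ => Y (i + 1)) k
    (Submodule.sum_mem _ fun j hj => Submodule.smul_mem _ _ (Submodule.subset_span ?_))
  have hj := Finset.mem_range.1 hj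
  -- Lag `j + 1` before time `k + 1` is time `k - j`, and the family at index `i` has time `i + 1`.
  refine ⟨k - j - 1, ?_, ?_⟩
  · change k - j - 1 < k
    omega
  · simp only
    congr 1
    omega

/-- The one-step prediction error variances tend to the innovation variance. -/
theorem tendsto_norm_sq_gramSchmidt (hv : 0 < v)
    (hε : ∀ i j, inner ℝ (ε i) (ε j) = if i = j then v else 0)
    (hst : ∀ m n k, inner ℝ (Y (m + k)) (Y (n + k)) = inner ℝ (Y m) (Y n))
    {a c : ℕ → ℝ} (ha : a 0 = 1) (hY : ∀ n, HasSum (fun j : ℕ => a j • ε (n - j)) (Y n))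
    (hc : c 0 = 1) (heq : Tendsto (fun N : ℕ => ∑ k ∈ Finset.range N, c k • Y (0 - k))
      atTop (𝓝 (ε 0))) :
    Tendsto (fun k => ‖InnerProductSpace.gramSchmidt ℝ (fun i : ℕ => Y (i + 1)) k‖ ^ 2)
      atTop (𝓝 v) := by
  have h := (heq.comp (tendsto_add_atTop_nat 1)).norm.pow 2
  rw [← real_inner_self_eq_norm_sq, hε, if_pos rfl] at h
  refine tendsto_of_tendsto_of_tendsto_of_le_of_le tendsto_const_nhds h
    (fun k => le_norm_sq_gramSchmidt hv hε ha hY k) fun k => ?_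
  simp only [Function.comp]
  gcongr
  exact norm_gramSchmidt_le_norm_sum hst hc k

end Innovations

/-! ### Entropy of product Gaussians and its invariance under affine maps of determinant one. -/

section Entropy

theorem pi_gaussianReal_eq_withDensity {n : ℕ} (m : Fin n → ℝ) {v : Fin n → NNReal}
    (hv : ∀ i, v i ≠ 0) :
    Measure.pi (fun i => gaussianReal (m i) (v i)) = (volume : Measure (Fin n → ℝ)).withDensity
      fun x => ENNReal.ofReal (∏ i, gaussianPDFReal (m i) (v i) (x i)) := by
  refine Measure.pi_eq fun s hs => ?_
  rw [withDensity_apply _ (MeasurableSet.univ_pi hs), volume_pi, Measure.restrict_pi_pi,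
    ← ofReal_integral_eq_lintegral_ofReal
      (Integrable.fintype_prod fun i => (integrable_gaussianPDFReal (m i) (v i)).restrict)
      (Eventually.of_forall fun x => Finset.prod_nonneg fun i _ => gaussianPDFReal_nonneg _ _ _),
    integral_fintype_prod_eq_prod (fun i x => gaussianPDFReal (m i) (v i) x),
    ENNReal.ofReal_prod_of_nonneg
      fun i _ => integral_nonneg fun x => gaussianPDFReal_nonneg _ _ _]
  exact Finset.prod_congr rfl fun i _ => (gaussianReal_apply_eq_integral _ (hv i) _).symm

theorem log_gaussianPDFReal (m : ℝ) {v : NNReal} (hv : v ≠ 0) (x : ℝ) :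
    Real.log (gaussianPDFReal m v x)
      = -(1 / 2 * Real.log (2 * Real.pi * v)) - (x - m) ^ 2 / (2 * v) := by
  have hv' : (0 : ℝ) < v := NNReal.coe_pos.2 (pos_iff_ne_zero.2 hv)
  rw [gaussianPDFReal, Real.log_mul (by positivity) (by positivity), Real.log_exp, Real.log_inv,
    Real.log_sqrt (by positivity)]
  ring

theorem integrable_sub_sq_gaussianReal (m : ℝ) (v : NNReal) :
    Integrable (fun x => (x - m) ^ 2) (gaussianReal m v) :=
  ((memLp_id_gaussianReal' 2 (by simp)).sub (memLp_const m)).integrable_sq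

theorem integrable_log_gaussianPDFReal (m : ℝ) {v : NNReal} (hv : v ≠ 0) :
    Integrable (fun x => Real.log (gaussianPDFReal m v x)) (gaussianReal m v) := by
  simp only [log_gaussianPDFReal m hv]
  exact (integrable_const _).sub ((integrable_sub_sq_gaussianReal m v).div_const _)

theorem integral_log_gaussianPDFReal (m : ℝ) {v : NNReal} (hv : v ≠ 0) :
    ∫ x, Real.log (gaussianPDFReal m v x) ∂gaussianReal m v
      = -(1 / 2 * Real.log (2 * Real.pi * Real.exp 1 * v)) := by
  have hv' : (0 : ℝ) < v := NNReal.coe_pos.2 (pos_iff_ne_zero.2 hv)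
  have hvar : ∫ x, (x - m) ^ 2 ∂gaussianReal m v = v := by
    have h := variance_fun_id_gaussianReal (μ := m) (v := v)
    rwa [variance_eq_integral (by fun_prop), integral_id_gaussianReal] at h
  simp only [log_gaussianPDFReal m hv]
  rw [integral_sub (integrable_const _) ((integrable_sub_sq_gaussianReal m v).div_const _),
    integral_div, hvar, integral_const, show 2 * Real.pi * Real.exp 1 * (v : ℝ)
      = 2 * Real.pi * v * Real.exp 1 by ring,
    Real.log_mul (x := 2 * Real.pi * v) (by positivity) (by positivity), Real.log_exp]
  simp
  field_simp
  ring

/-- Absorbing the factor `f` of `f log f` into the measure makes entropy an expectation of `log f`,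
which is additive over independent coordinates. -/
theorem hasFiniteDiffEntropy_iff {n : ℕ} {μ : Measure (Fin n → ℝ)} [SigmaFinite μ] :
    HasFiniteDiffEntropy μ
      ↔ μ ≪ volume ∧ Integrable (fun x => Real.log (lebesgueDensity μ x)) μ := by
  refine and_congr_right fun hμ => ?_
  rw [← integrable_toReal_rnDeriv_mul_iff hμ, ← integrable_neg_iff]
  refine integrable_congr (Eventually.of_forall fun x => ?_)
  simp [Real.negMulLog, lebesgueDensity]

theorem diffEntropy_eq_neg_integral_log {n : ℕ} {μ : Measure (Fin n → ℝ)} [SigmaFinite μ]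
    (hμ : μ ≪ volume) : diffEntropy μ = -∫ x, Real.log (lebesgueDensity μ x) ∂μ := by
  rw [← integral_toReal_rnDeriv_mul hμ, ← integral_neg]
  simp [diffEntropy, Real.negMulLog, lebesgueDensity]

theorem log_lebesgueDensity_pi_gaussianReal {n : ℕ} (m : Fin n → ℝ) {v : Fin n → NNReal}
    (hv : ∀ i, v i ≠ 0) :
    (fun x => Real.log (lebesgueDensity (Measure.pi fun i => gaussianReal (m i) (v i)) x))
      =ᵐ[Measure.pi fun i => gaussianReal (m i) (v i)]
        fun x => ∑ i, Real.log (gaussianPDFReal (m i) (v i) (x i)) := by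
  have hd := pi_gaussianReal_eq_withDensity m hv
  have hac : Measure.pi (fun i => gaussianReal (m i) (v i)) ≪ volume :=
    hd ▸ withDensity_absolutelyContinuous _ _
  have hmeas : Measurable fun x : Fin n → ℝ =>
      ENNReal.ofReal (∏ i, gaussianPDFReal (m i) (v i) (x i)) := by
    refine ENNReal.measurable_ofReal.comp (Finset.measurable_prod _ fun i _ => ?_)
    exact (measurable_gaussianPDFReal _ _).comp (measurable_pi_apply i)
  have h := Measure.rnDeriv_withDensity (volume : Measure (Fin n → ℝ)) hmeas
  rw [← hd] at h
  filter_upwards [hac.ae_le h] with x hx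
  rw [lebesgueDensity, hx, ENNReal.toReal_ofReal
    (Finset.prod_nonneg fun i _ => gaussianPDFReal_nonneg _ _ _),
    Real.log_prod fun i _ => (gaussianPDFReal_pos _ _ _ (hv i)).ne']

theorem integrable_log_gaussianPDFReal_eval {n : ℕ} (m : Fin n → ℝ) {v : Fin n → NNReal}
    (hv : ∀ i, v i ≠ 0) (i : Fin n) :
    Integrable (fun x : Fin n → ℝ => Real.log (gaussianPDFReal (m i) (v i) (x i)))
      (Measure.pi fun i => gaussianReal (m i) (v i)) :=
  integrable_comp_eval (μ := fun i => gaussianReal (m i) (v i))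
    (integrable_log_gaussianPDFReal (m i) (hv i))

theorem hasFiniteDiffEntropy_pi_gaussianReal {n : ℕ} (m : Fin n → ℝ) {v : Fin n → NNReal}
    (hv : ∀ i, v i ≠ 0) :
    HasFiniteDiffEntropy (Measure.pi fun i => gaussianReal (m i) (v i)) := by
  refine hasFiniteDiffEntropy_iff.2 ⟨?_, ?_⟩
  · rw [pi_gaussianReal_eq_withDensity m hv]
    exact withDensity_absolutelyContinuous _ _
  · rw [integrable_congr (log_lebesgueDensity_pi_gaussianReal m hv)]
    exact integrable_finsetSum _ fun i _ => integrable_log_gaussianPDFReal_eval m hv i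

theorem diffEntropy_pi_gaussianReal {n : ℕ} (m : Fin n → ℝ) {v : Fin n → NNReal}
    (hv : ∀ i, v i ≠ 0) :
    diffEntropy (Measure.pi fun i => gaussianReal (m i) (v i))
      = ∑ i, 1 / 2 * Real.log (2 * Real.pi * Real.exp 1 * v i) := by
  rw [diffEntropy_eq_neg_integral_log (hasFiniteDiffEntropy_pi_gaussianReal m hv).1,
    integral_congr_ae (log_lebesgueDensity_pi_gaussianReal m hv),
    integral_finsetSum _ fun i _ => integrable_log_gaussianPDFReal_eval m hv i,
    ← Finset.sum_neg_distrib]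
  refine Finset.sum_congr rfl fun i _ => ?_
  rw [integral_comp_eval (μ := fun i => gaussianReal (m i) (v i))
    (f := fun x => Real.log (gaussianPDFReal (m i) (v i) x))
    (integrable_log_gaussianPDFReal (m i) (hv i)).aestronglyMeasurable,
    integral_log_gaussianPDFReal (m i) (hv i), neg_neg]

theorem lebesgueDensity_map {n : ℕ} {g : (Fin n → ℝ) → Fin n → ℝ} (hg : MeasurableEmbedding g)
    (hvol : MeasurePreserving g volume volume) (μ : Measure (Fin n → ℝ)) [SigmaFinite μ] :
    (fun x => lebesgueDensity (μ.map g) (g x)) =ᵐ[volume] lebesgueDensity μ := by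
  have h := hg.rnDeriv_map μ volume
  rw [hvol.map_eq] at h
  filter_upwards [h] with x hx
  simp only [lebesgueDensity, hx]

theorem HasFiniteDiffEntropy.map {n : ℕ} {g : (Fin n → ℝ) → Fin n → ℝ}
    (hg : MeasurableEmbedding g) (hvol : MeasurePreserving g volume volume)
    {μ : Measure (Fin n → ℝ)} [SigmaFinite μ] (hμ : HasFiniteDiffEntropy μ) :
    HasFiniteDiffEntropy (μ.map g) := by
  refine ⟨?_, ?_⟩
  · rw [← hvol.map_eq]
    exact hμ.1.map hg.measurable
  · rw [← hvol.integrable_comp_emb hg]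
    refine hμ.2.congr ?_
    filter_upwards [lebesgueDensity_map hg hvol μ] with x hx
    simp only [Function.comp, hx]

theorem diffEntropy_map {n : ℕ} {g : (Fin n → ℝ) → Fin n → ℝ} (hg : MeasurableEmbedding g)
    (hvol : MeasurePreserving g volume volume) (μ : Measure (Fin n → ℝ)) [SigmaFinite μ] :
    diffEntropy (μ.map g) = diffEntropy μ := by
  rw [diffEntropy, ← hvol.integral_comp hg]
  refine integral_congr_ae ?_
  filter_upwards [lebesgueDensity_map hg hvol μ] with x hx
  simp only [hx]

theorem measurableEmbedding_mulVec_add {n : ℕ} {M : Matrix (Fin n) (Fin n) ℝ} (hM : M.det = 1)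
    (m : Fin n → ℝ) : MeasurableEmbedding fun x => M.mulVec x + m := by
  refine Continuous.measurableEmbedding (by fun_prop) ?_
  refine (add_left_injective m).comp ?_
  rw [Matrix.mulVec_injective_iff_isUnit, Matrix.isUnit_iff_isUnit_det, hM]
  exact isUnit_one

theorem measurePreserving_mulVec_add {n : ℕ} {M : Matrix (Fin n) (Fin n) ℝ} (hM : M.det = 1)
    (m : Fin n → ℝ) :
    MeasurePreserving (fun x => M.mulVec x + m) (volume : Measure (Fin n → ℝ)) volume := by
  refine (measurePreserving_add_right volume m).comp ⟨by fun_prop, ?_⟩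
  have h := Real.map_matrix_volume_pi_eq_smul_volume_pi (M := M) (by rw [hM]; exact one_ne_zero)
  rw [hM] at h
  have hcoe : (Matrix.toLin' M : (Fin n → ℝ) → Fin n → ℝ) = M.mulVec := by ext1 x; simp
  simpa [hcoe] using h

end Entropy

/-! ### The closed span of the noise in `L²` is a Gaussian space. -/

section GaussianSpace

variable {Ω : Type*} [MeasurableSpace Ω] {P : Measure Ω}

theorem norm_cexp_mul_I_sub_le (x y : ℝ) :
    ‖Complex.exp (x * Complex.I) - Complex.exp (y * Complex.I)‖ ≤ |x - y| := by
  have h : Complex.exp (x * Complex.I) - Complex.exp (y * Complex.I)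
      = Complex.exp (y * Complex.I) * (Complex.exp (Complex.I * (x - y : ℝ)) - 1) := by
    rw [mul_sub, ← Complex.exp_add, mul_one]
    congr 2
    push_cast
    ring
  rw [h, norm_mul, Complex.norm_exp_ofReal_mul_I, one_mul]
  exact Real.norm_exp_I_mul_ofReal_sub_one_le

theorem integral_abs_le_norm [IsProbabilityMeasure P] (u : Lp ℝ 2 P) : ∫ ω, |u ω| ∂P ≤ ‖u‖ := by
  have h1 : eLpNorm u 1 P ≤ eLpNorm u 2 P :=
    eLpNorm_le_eLpNorm_of_exponent_le (by norm_num) (Lp.aestronglyMeasurable u)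
  have h2 := ENNReal.toReal_mono (Lp.memLp u).eLpNorm_ne_top h1
  rw [Lp.norm_def]
  refine le_trans (le_of_eq ?_) h2
  rw [eLpNorm_one_eq_lintegral_enorm]
  exact integral_norm_eq_lintegral_enorm (Lp.aestronglyMeasurable u)

theorem integrable_cexp_mul_I [IsProbabilityMeasure P] {f : Ω → ℝ} (hf : AEStronglyMeasurable f P) :
    Integrable (fun ω => Complex.exp (f ω * Complex.I)) P := by
  refine Integrable.of_bound (C := 1) ?_ (Eventually.of_forall fun ω => ?_)
  · have : Continuous fun x : ℝ => Complex.exp (x * Complex.I) := by fun_prop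
    exact this.comp_aestronglyMeasurable hf
  · rw [Complex.norm_exp_ofReal_mul_I]

/-- The map `x ↦ exp (i x)` is 1-Lipschitz and the `L¹` norm is at most the `L²` norm. -/
theorem continuous_integral_cexp_mul_I [IsProbabilityMeasure P] :
    Continuous fun u : Lp ℝ 2 P => ∫ ω, Complex.exp (u ω * Complex.I) ∂P := by
  refine LipschitzWith.continuous (K := 1) (LipschitzWith.of_dist_le_mul fun u w => ?_)
  rw [NNReal.coe_one, one_mul, dist_eq_norm, dist_eq_norm,
    ← integral_sub (integrable_cexp_mul_I (Lp.aestronglyMeasurable u))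
      (integrable_cexp_mul_I (Lp.aestronglyMeasurable w))]
  refine le_trans ?_ (integral_abs_le_norm (u - w))
  refine norm_integral_le_of_norm_le
    (((Lp.memLp (u - w)).integrable (by norm_num)).abs) ?_
  filter_upwards [Lp.coeFn_sub u w] with ω hω
  rw [hω]
  exact norm_cexp_mul_I_sub_le _ _

theorem inner_toLp_eq_integral {f g : Ω → ℝ} (hf : MemLp f 2 P) (hg : MemLp g 2 P) :
    inner ℝ (hf.toLp f) (hg.toLp g) = ∫ ω, f ω * g ω ∂P := by
  rw [L2.inner_def]
  refine integral_congr_ae ?_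
  filter_upwards [hf.coeFn_toLp, hg.coeFn_toLp] with ω h1 h2
  rw [h1, h2]
  simp [mul_comm]

theorem coeFn_sum_smul {ι : Type*} (s : Finset ι) (c : ι → ℝ) (u : ι → Lp ℝ 2 P) :
    (∑ i ∈ s, c i • u i : Lp ℝ 2 P) =ᵐ[P] fun ω => ∑ i ∈ s, c i * u i ω := by
  have h := Lp.coeFn_finsetSum s (fun i => c i • u i)
  have h2 : ∀ᵐ ω ∂P, ∀ i ∈ s, (c i • u i : Lp ℝ 2 P) ω = c i * u i ω := by
    rw [Filter.eventually_all_finset]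
    intro i _
    filter_upwards [Lp.coeFn_smul (c i) (u i)] with ω hω
    rw [hω]; rfl
  filter_upwards [h, h2] with ω h3 h4
  rw [h3, Finset.sum_apply]
  exact Finset.sum_congr rfl h4

theorem IsGaussianWhiteNoise.integral_cexp_sum [IsProbabilityMeasure P] {ε : ℤ → Ω → ℝ} {v : NNReal}
    (hε : IsGaussianWhiteNoise P ε v) (s : Finset ℤ) (c : ℤ → ℝ) :
    ∫ ω, Complex.exp ((∑ i ∈ s, c i * ε i ω : ℝ) * Complex.I) ∂P
      = Complex.exp (-((∑ i ∈ s, c i ^ 2 * v : ℝ) / 2)) := by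
  have hm : ∀ i : s, AEMeasurable (ε i) P := fun i => (hε.hasLaw i).aemeasurable
  have h := (iIndepFun_iff_charFun_pi hm).1 (hε.indep.precomp Subtype.val_injective)
    (WithLp.toLp 2 fun i : s => c i)
  rw [charFun_apply, integral_map (by fun_prop) (by fun_prop)] at h
  simp only [PiLp.inner_apply, (hε.hasLaw _).map_eq, charFun_gaussianReal, ← Complex.exp_sum] at h
  simp only [← Finset.sum_coe_sort s]
  convert h using 2
  · simp
  · push_cast
    rw [Finset.sum_div, ← Finset.sum_neg_distrib]
    refine Finset.sum_congr rfl fun i _ => ?_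
    ring_nf

/-- Both sides are continuous in `u`, so finite combinations suffice. Frequency 1 is enough, since
the closed span contains all multiples of `u`. -/
theorem IsGaussianWhiteNoise.integral_cexp_of_mem_closure [IsProbabilityMeasure P] {ε : ℤ → Ω → ℝ} {v : NNReal}
    (hε : IsGaussianWhiteNoise P ε v) {e : ℤ → Lp ℝ 2 P} (he : ∀ i, e i =ᵐ[P] ε i)
    (horth : ∀ i j, inner ℝ (e i) (e j) = if i = j then (v : ℝ) else 0) {u : Lp ℝ 2 P}
    (hu : u ∈ closure (Submodule.span ℝ (Set.range e) : Set (Lp ℝ 2 P))) :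
    ∫ ω, Complex.exp (u ω * Complex.I) ∂P = Complex.exp (-((‖u‖ ^ 2 : ℝ) / 2)) := by
  have hcl : IsClosed {u : Lp ℝ 2 P |
      ∫ ω, Complex.exp (u ω * Complex.I) ∂P = Complex.exp (-((‖u‖ ^ 2 : ℝ) / 2))} :=
    isClosed_eq continuous_integral_cexp_mul_I (by fun_prop)
  refine closure_minimal ?_ hcl hu
  intro w hw
  obtain ⟨c, rfl⟩ := Finsupp.mem_span_range_iff_exists_finsupp.1 hw
  simp only [Finsupp.sum, Set.mem_ofPred_eq]
  have hn : ‖∑ i ∈ c.support, c i • e i‖ ^ 2 = ∑ i ∈ c.support, c i ^ 2 * v := by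
    rw [← real_inner_self_eq_norm_sq]
    simp only [sum_inner, inner_sum, inner_smul_left, inner_smul_right, horth, conj_trivial,
      mul_ite, mul_zero, Finset.sum_ite_eq']
    refine Finset.sum_congr rfl fun i hi => ?_
    rw [if_pos hi]
    ring
  rw [hn, ← hε.integral_cexp_sum]
  refine integral_congr_ae ?_
  have h2 : ∀ᵐ ω ∂P, ∀ i ∈ c.support, e i ω = ε i ω :=
    (Filter.eventually_all_finset _).2 fun i _ => he i
  filter_upwards [coeFn_sum_smul c.support c e, h2] with ω h3 h4
  rw [h3, Finset.sum_congr rfl fun i hi => by rw [h4 i hi]]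

/-- Orthogonal elements of the closed span of a Gaussian white noise are independent normal. -/
theorem IsGaussianWhiteNoise.map_eq_pi_gaussianReal [IsProbabilityMeasure P] {ε : ℤ → Ω → ℝ} {v : NNReal}
    (hε : IsGaussianWhiteNoise P ε v) {e : ℤ → Lp ℝ 2 P} (he : ∀ i, e i =ᵐ[P] ε i)
    (horth : ∀ i j, inner ℝ (e i) (e j) = if i = j then (v : ℝ) else 0) {n : ℕ}
    {u : Fin n → Lp ℝ 2 P}
    (hu : ∀ i, u i ∈ closure (Submodule.span ℝ (Set.range e) : Set (Lp ℝ 2 P)))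
    (huo : Pairwise fun i j => inner ℝ (u i) (u j) = 0) :
    P.map (fun ω i => u i ω) = Measure.pi fun i => gaussianReal 0 (‖u i‖₊ ^ 2) := by
  have hm : AEMeasurable (fun ω i => u i ω) P :=
    aemeasurable_pi_lambda _ fun i => (Lp.aestronglyMeasurable (u i)).aemeasurable
  have hprob : IsProbabilityMeasure (P.map fun ω i => u i ω) := Measure.isProbabilityMeasure_map hm
  refine charFun_eq_pi_iff.1 fun t => ?_
  -- The joint characteristic function at `t` is that of this single element, and by orthogonality
  -- its squared norm splits, so the exponential factorises.
  have hmem : ∑ i, t i • u i ∈ closure (Submodule.span ℝ (Set.range e) : Set (Lp ℝ 2 P)) := by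
    rw [← Submodule.topologicalClosure_coe]
    exact Submodule.sum_mem _ fun i _ => Submodule.smul_mem _ _ (hu i)
  have hn : ‖∑ i, t i • u i‖ ^ 2 = ∑ i, t i ^ 2 * ‖u i‖ ^ 2 := by
    rw [← real_inner_self_eq_norm_sq]
    simp only [sum_inner, inner_sum, inner_smul_left, inner_smul_right, conj_trivial]
    refine Finset.sum_congr rfl fun i _ => ?_
    rw [Finset.sum_eq_single i (fun j _ hj => by simp [huo hj]) (by simp),
      real_inner_self_eq_norm_sq]
    ring
  have h := hε.integral_cexp_of_mem_closure he horth hmem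
  rw [hn] at h
  rw [charFun_apply, integral_map (by fun_prop) (by fun_prop), integral_map hm (by fun_prop)]
  simp only [charFun_gaussianReal, ← Complex.exp_sum]
  convert h using 1
  · refine integral_congr_ae ?_
    filter_upwards [coeFn_sum_smul Finset.univ t u] with ω hω
    rw [hω, PiLp.inner_apply]
    simp
  · congr 1
    push_cast
    rw [Finset.sum_div, ← Finset.sum_neg_distrib]
    refine Finset.sum_congr rfl fun i _ => ?_
    ring_nf

end GaussianSpace

/-! ### The law of `(X 1, …, X n)` as a unimodular affine image of independent normals. -/

section JointLaw

open InnerProductSpace in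
/-- The unitriangular change of basis of the Gram–Schmidt process. -/
theorem exists_det_eq_one_gramSchmidt {E : Type*} [NormedAddCommGroup E] [InnerProductSpace ℝ E]
    (f : ℕ → E) (n : ℕ) : ∃ M : Matrix (Fin n) (Fin n) ℝ, M.det = 1 ∧
      ∀ i : Fin n, f i = ∑ k, M i k • gramSchmidt ℝ f k := by
  -- When a residual vanishes, division by zero makes its coefficient 0 below the diagonal, which is
  -- harmless; the diagonal stays 1 regardless.
  set a : ℕ → ℕ → ℝ := fun i k => if k = i then 1 else if k < i then
    inner ℝ (gramSchmidt ℝ f k) (f i) / ‖gramSchmidt ℝ f k‖ ^ 2 else 0 with ha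
  refine ⟨Matrix.of fun i k => a i k, ?_, fun i => ?_⟩
  · rw [Matrix.det_of_isLowerTriangular]
    · simp [ha]
    · intro i k hik
      have hik : (i : ℕ) < k := hik
      simp only [Matrix.of_apply, ha]
      rw [if_neg (by omega), if_neg (by omega)]
  · simp only [Matrix.of_apply]
    rw [Fin.sum_univ_eq_sum_range (fun k => a i k • gramSchmidt ℝ f k) n,
      ← Finset.sum_subset (s₁ := Finset.range (i + 1)) (fun k hk => by
        simp only [Finset.mem_range] at hk ⊢; omega) (fun k _ hk => by
        simp only [Finset.mem_range, not_lt] at hk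
        simp only [ha]
        rw [if_neg (by omega), if_neg (by omega), zero_smul]),
      Finset.sum_range_succ]
    conv_lhs => rw [gramSchmidt_def'' ℝ f i]
    rw [add_comm]
    congr 1
    · rw [Nat.Iio_eq_range]
      refine Finset.sum_congr rfl fun k hk => ?_
      have hk := Finset.mem_range.1 hk
      simp only [ha]
      rw [if_neg (by omega), if_pos hk]
      rfl
    · simp [ha]

variable {Ω : Type*} [MeasurableSpace Ω] {P : Measure Ω}

open InnerProductSpace in
theorem jointLaw_eq_map_pi_gaussianReal [IsProbabilityMeasure P] {X ε : ℤ → Ω → ℝ} {v : NNReal}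
    (hε : IsGaussianWhiteNoise P ε v) {e Y : ℤ → Lp ℝ 2 P} (he : ∀ i, e i =ᵐ[P] ε i)
    (horth : ∀ i j, inner ℝ (e i) (e j) = if i = j then (v : ℝ) else 0)
    {m : ℝ} (hXY : ∀ i, X i =ᵐ[P] fun ω => Y i ω + m)
    (hY : ∀ i, Y i ∈ closure (Submodule.span ℝ (Set.range e) : Set (Lp ℝ 2 P))) (n : ℕ) :
    ∃ M : Matrix (Fin n) (Fin n) ℝ, M.det = 1 ∧
      jointLaw P X n = (Measure.pi fun i : Fin n => gaussianReal 0
        (‖gramSchmidt ℝ (fun k : ℕ => Y (k + 1)) i‖₊ ^ 2)).map fun x => M.mulVec x + fun _ => m := by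
  set f : ℕ → Lp ℝ 2 P := fun k => Y (k + 1) with hf
  obtain ⟨M, hM, hfM⟩ := exists_det_eq_one_gramSchmidt f n
  refine ⟨M, hM, ?_⟩
  have hu : ∀ i : Fin n, gramSchmidt ℝ f i
      ∈ closure (Submodule.span ℝ (Set.range e) : Set (Lp ℝ 2 P)) := by
    intro i
    rw [← Submodule.topologicalClosure_coe]
    have hle : Submodule.span ℝ (f '' Set.Iic (i : ℕ))
        ≤ (Submodule.span ℝ (Set.range e)).topologicalClosure := by
      rw [Submodule.span_le]
      rintro _ ⟨k, _, rfl⟩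
      rw [Submodule.topologicalClosure_coe]
      exact hY _
    exact hle (gramSchmidt_mem_span ℝ f le_rfl)
  have hlaw := hε.map_eq_pi_gaussianReal he horth hu fun i j hij =>
    gramSchmidt_orthogonal ℝ f (Fin.val_injective.ne hij)
  rw [← hlaw, AEMeasurable.map_map_of_aemeasurable (by fun_prop)
    (aemeasurable_pi_lambda _ fun i => (Lp.aestronglyMeasurable _).aemeasurable)]
  refine Measure.map_congr ?_
  have h1 : ∀ᵐ ω ∂P, ∀ i : Fin n, X ((i : ℤ) + 1) ω = f i ω + m :=
    ae_all_iff.2 fun i => hXY _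
  have h2 : ∀ᵐ ω ∂P, ∀ i : Fin n, f i ω = ∑ k, M i k * gramSchmidt ℝ f k ω := by
    refine ae_all_iff.2 fun i => ?_
    rw [hfM i]
    exact coeFn_sum_smul Finset.univ (M i) fun k : Fin n => gramSchmidt ℝ f k
  filter_upwards [h1, h2] with ω h3 h4
  ext i
  simp only [Function.comp, Pi.add_apply, Matrix.mulVec, dotProduct]
  rw [h3, h4]

theorem IsGaussianWhiteNoise.memLp {ε : ℤ → Ω → ℝ} {v : NNReal}
    (hε : IsGaussianWhiteNoise P ε v) (i : ℤ) : MemLp (ε i) 2 P := by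
  have h := memLp_id_gaussianReal' (μ := 0) (v := v) 2 (by simp)
  rw [← (hε.hasLaw i).map_eq, memLp_map_measure_iff (by fun_prop) (hε.hasLaw i).aemeasurable] at h
  exact h

theorem IsGaussianWhiteNoise.integral_eq_zero {ε : ℤ → Ω → ℝ} {v : NNReal}
    (hε : IsGaussianWhiteNoise P ε v) (i : ℤ) : ∫ ω, ε i ω ∂P = 0 := by
  rw [(hε.hasLaw i).integral_eq, integral_id_gaussianReal]

theorem IsGaussianWhiteNoise.integral_mul [IsProbabilityMeasure P] {ε : ℤ → Ω → ℝ} {v : NNReal}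
    (hε : IsGaussianWhiteNoise P ε v) (i j : ℤ) :
    ∫ ω, ε i ω * ε j ω ∂P = if i = j then (v : ℝ) else 0 := by
  split_ifs with hij
  · subst hij
    have h := (hε.hasLaw i).variance_eq
    rw [variance_id_gaussianReal, variance_of_integral_eq_zero (hε.hasLaw i).aemeasurable
      (hε.integral_eq_zero i)] at h
    rw [← h]
    exact integral_congr_ae (Eventually.of_forall fun ω => (sq _).symm)
  · rw [(hε.indep.indepFun hij).integral_fun_mul_eq_mul_integral
      (hε.memLp i).aestronglyMeasurable (hε.memLp j).aestronglyMeasurable,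
      hε.integral_eq_zero, zero_mul]

theorem FracDiffEq.tendsto_toLp {d : ℝ} {X ε : ℤ → Ω → ℝ} (h : FracDiffEq P d X ε)
    (hX : ∀ n, MemLp (X n) 2 P) (hε : ∀ n, MemLp (ε n) 2 P) (n : ℤ) :
    Tendsto (fun N : ℕ => ∑ k ∈ Finset.range N,
      fracDiffCoeff d k • (hX (n - k)).toLp (X (n - k))) atTop (𝓝 ((hε n).toLp (ε n))) := by
  rw [Lp.tendsto_Lp_iff_tendsto_eLpNorm']
  refine (h n).congr fun N => eLpNorm_congr_ae ?_
  have h1 : ∀ᵐ ω ∂P, ∀ k : ℕ, (hX (n - k)).toLp (X (n - k)) ω = X (n - k) ω :=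
    ae_all_iff.2 fun k => (hX (n - k)).coeFn_toLp
  filter_upwards [coeFn_sum_smul (Finset.range N) (fracDiffCoeff d)
    (fun k : ℕ => (hX (n - k)).toLp (X (n - k))), (hε n).coeFn_toLp, h1] with ω h2 h3 h4
  rw [Pi.sub_apply, h2, h3]
  simp only [h4]

/-- The equation `(1 - L) ^ d X = ε` passes to the centred process. -/
theorem FracDiffEq.tendsto_toLp_centered [IsProbabilityMeasure P] {d m : ℝ} {X ε : ℤ → Ω → ℝ} (h : FracDiffEq P d X ε)
    (hX : ∀ n, MemLp (X n) 2 P) (hε : ∀ n, MemLp (ε n) 2 P) (hXm : ∀ n, ∫ ω, X n ω ∂P = m)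
    (hε0 : ∀ n, ∫ ω, ε n ω ∂P = 0) (n : ℤ) :
    Tendsto (fun N : ℕ => ∑ k ∈ Finset.range N, fracDiffCoeff d k •
      ((hX (n - k)).sub (memLp_const m)).toLp (X (n - k) - fun _ => m)) atTop
      (𝓝 ((hε n).toLp (ε n))) := by
  have h1 : MemLp (fun _ : Ω => (1 : ℝ)) 2 P := memLp_const 1
  set u : Lp ℝ 2 P := h1.toLp _ with hu
  -- Centring is the continuous projection onto the complement of the constants, so it passes
  -- through the limit. Subtracting the mean term by term would require the series of coefficients
  -- to converge, which may fail for `d < 0`.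
  set Q : Lp ℝ 2 P →L[ℝ] Lp ℝ 2 P :=
    ContinuousLinearMap.id ℝ _ - (innerSL ℝ u).smulRight u with hQ
  have hQf : ∀ (g : Ω → ℝ) (hg : MemLp g 2 P), Q (hg.toLp g)
      = (hg.sub (memLp_const (∫ ω, g ω ∂P))).toLp (g - fun _ => ∫ ω, g ω ∂P) := by
    intro g hg
    have hin : inner ℝ u (hg.toLp g) = ∫ ω, g ω ∂P := by
      rw [hu, inner_toLp_eq_integral]
      simp
    rw [MemLp.toLp_sub hg (memLp_const _)]
    simp only [hQ, sub_apply, ContinuousLinearMap.id_apply,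
      ContinuousLinearMap.smulRight_apply, innerSL_apply_apply, hin]
    congr 1
    rw [hu, ← MemLp.toLp_const_smul]
    congr 1
    ext ω
    simp
  have h2 := (Q.continuous.tendsto _).comp (h.tendsto_toLp hX hε n)
  have h3 : Q ((hε n).toLp (ε n)) = (hε n).toLp (ε n) := by
    rw [hQf]
    congr 1
    ext ω
    simp [hε0]
  rw [h3] at h2
  refine h2.congr fun N => ?_
  simp only [Function.comp, map_sum, map_smul, hQf, hXm]

end JointLaw

/-! ### Assembly of the entropy rate. -/

theorem mainTheorem7 {Ω : Type*} [MeasurableSpace Ω] (P : Measure Ω) [IsProbabilityMeasure P]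
    (H σ : ℝ) (hH0 : 0 < H) (hH1 : H < 1) (hσ : 0 < σ)
    (X : ℤ → Ω → ℝ) (hX : IsARFIMA P (H - 1 / 2) X) (hvar : ∀ n, Var[X n; P] = σ ^ 2) :
    HasDiffEntropyRate P X
      (1 / 2 * Real.log (2 * Real.pi * Real.exp 1 * σ ^ 2)
        + Real.log (Real.Gamma (3 / 2 - H)) - 1 / 2 * Real.log (Real.Gamma (2 - 2 * H))) := by
  obtain ⟨v, ε, hε, hXε⟩ := hX.exists_noise
  set d := H - 1 / 2 with hd
  have hd1 : d < 1 / 2 := by linarith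
  have hXL := hX.stationary.memLp
  set m := ∫ ω, X 0 ω ∂P with hm
  have hXm : ∀ n, ∫ ω, X n ω ∂P = m := fun n => hX.stationary.mean_eq n 0
  set e : ℤ → Lp ℝ 2 P := fun n => (hε.memLp n).toLp (ε n) with he
  have hYL : ∀ n, MemLp (X n - fun _ => m) 2 P := fun n => (hXL n).sub (memLp_const m)
  set Y : ℤ → Lp ℝ 2 P := fun n => (hYL n).toLp (X n - fun _ => m) with hY
  have hee : ∀ i, e i =ᵐ[P] ε i := fun i => (hε.memLp i).coeFn_toLp
  have horth : ∀ i j, inner ℝ (e i) (e j) = if i = j then (v : ℝ) else 0 := fun i j => by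
    rw [he, inner_toLp_eq_integral, hε.integral_mul]
  have hcov : ∀ i j, inner ℝ (Y i) (Y j) = cov[X i, X j; P] := fun i j => by
    rw [hY, inner_toLp_eq_integral, covariance, hXm, hXm]
    rfl
  have hst : ∀ m n k, inner ℝ (Y (m + k)) (Y (n + k)) = inner ℝ (Y m) (Y n) := fun m n k => by
    rw [hcov, hcov, hX.stationary.cov_shift]
  have hdecay : Tendsto (fun k : ℕ => inner ℝ (Y 0) (Y k)) atTop (𝓝 0) := by
    simpa only [hcov] using hX.cov_tendsto_zero
  have heq : ∀ n, Tendsto (fun N : ℕ => ∑ k ∈ Finset.range N, fracDiffCoeff d k • Y (n - k))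
      atTop (𝓝 (e n)) :=
    hXε.tendsto_toLp_centered hXL hε.memLp hXm hε.integral_eq_zero
  have hMA := hasSum_fracDiffCoeff_neg_smul hd1 horth hst hdecay heq
  have hXY : ∀ i, X i =ᵐ[P] fun ω => Y i ω + m := fun i => by
    filter_upwards [(hYL i).coeFn_toLp] with ω hω
    rw [hY, hω]
    simp
  have hYmem : ∀ i, Y i ∈ closure (Submodule.span ℝ (Set.range e) : Set (Lp ℝ 2 P)) := fun i =>
    mem_closure_of_tendsto (hMA i).tendsto_sum_nat (Eventually.of_forall fun N =>
      Submodule.sum_mem _ fun j _ => Submodule.smul_mem _ _ (Submodule.subset_span ⟨_, rfl⟩))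
  -- Parseval for the moving average at time 0.
  have hnorm : Real.Gamma (1 - 2 * d) / Real.Gamma (1 - d) ^ 2 * v = σ ^ 2 := by
    have h1 := norm_sq_hasSum_of_orthogonal (fun i j : ℕ => by
      rw [horth]
      congr 1
      simp) (hMA 0)
    rw [← real_inner_self_eq_norm_sq, hcov, covariance_self (hXL 0).aemeasurable, hvar] at h1
    rw [← tsum_fracDiffCoeff_neg_sq hd1, ← tsum_mul_right, h1.tsum_eq]
  have hG1 : 0 < Real.Gamma (1 - 2 * d) := Real.Gamma_pos_of_pos (by linarith)
  have hG2 : 0 < Real.Gamma (1 - d) := Real.Gamma_pos_of_pos (by linarith)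
  -- The noise is not assumed nondegenerate; its positive variance is forced by `σ > 0`.
  have hv : (0 : ℝ) < v := by
    refine pos_of_mul_pos_right ?_ (show 0 ≤ Real.Gamma (1 - 2 * d) / Real.Gamma (1 - d) ^ 2
      by positivity)
    rw [hnorm]
    positivity
  set w : ℕ → Lp ℝ 2 P := InnerProductSpace.gramSchmidt ℝ fun k : ℕ => Y (k + 1) with hw
  have hwv : ∀ k, (v : ℝ) ≤ ‖w k‖ ^ 2 :=
    le_norm_sq_gramSchmidt hv horth (fracDiffCoeff_zero_right _) hMA
  have hw0 : ∀ k, ‖w k‖₊ ^ 2 ≠ 0 := fun k hk => by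
    have h1 : ‖w k‖ ^ 2 = 0 := by simpa using congrArg NNReal.toReal hk
    linarith [hwv k]
  have hwlim : Tendsto (fun k => ‖w k‖ ^ 2) atTop (𝓝 v) :=
    tendsto_norm_sq_gramSchmidt hv horth hst (fracDiffCoeff_zero_right _) hMA
      (fracDiffCoeff_zero_right d) (heq 0)
  have hlaw := jointLaw_eq_map_pi_gaussianReal hε hee horth hXY hYmem
  refine ⟨fun n => ?_, ?_⟩
  · obtain ⟨M, hM, hMlaw⟩ := hlaw n
    rw [hMlaw]
    exact (hasFiniteDiffEntropy_pi_gaussianReal _ fun i : Fin n => hw0 i).map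
      (measurableEmbedding_mulVec_add hM _) (measurePreserving_mulVec_add hM _)
  · have hent : ∀ n : ℕ, diffEntropy (jointLaw P X n) = ∑ k ∈ Finset.range n,
        1 / 2 * Real.log (2 * Real.pi * Real.exp 1 * ‖w k‖ ^ 2) := by
      intro n
      obtain ⟨M, hM, hMlaw⟩ := hlaw n
      rw [hMlaw, diffEntropy_map (measurableEmbedding_mulVec_add hM _)
        (measurePreserving_mulVec_add hM _),
        diffEntropy_pi_gaussianReal _ fun i : Fin n => hw0 i, ← Fin.sum_univ_eq_sum_range]
      simp [hw]
    have hrate : 1 / 2 * Real.log (2 * Real.pi * Real.exp 1 * σ ^ 2)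
        + Real.log (Real.Gamma (3 / 2 - H)) - 1 / 2 * Real.log (Real.Gamma (2 - 2 * H))
        = 1 / 2 * Real.log (2 * Real.pi * Real.exp 1 * v) := by
      rw [show 3 / 2 - H = 1 - d by rw [hd]; ring, show 2 - 2 * H = 1 - 2 * d by rw [hd]; ring,
        ← hnorm, Real.log_mul (by positivity) (by positivity),
        Real.log_mul (x := _ / _) (by positivity) (by positivity),
        Real.log_div (by positivity) (by positivity), Real.log_pow,
        Real.log_mul (x := 2 * Real.pi * Real.exp 1) (by positivity) (by positivity)]
      push_cast
      ring
    rw [hrate]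
    have hlog : Tendsto (fun k => 1 / 2 * Real.log (2 * Real.pi * Real.exp 1 * ‖w k‖ ^ 2)) atTop
        (𝓝 (1 / 2 * Real.log (2 * Real.pi * Real.exp 1 * v))) :=
      ((hwlim.const_mul _).log (by positivity)).const_mul _
    -- The normalised entropy is the Cesàro mean of the convergent conditional entropies.
    refine hlog.cesaro.congr fun n => ?_
    rw [hent]
    exact (div_eq_inv_mul _ _).symm
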